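/- Let $m,k,r>0$ be real numbers, let $0=y_0<y_1<\dots<y_n=1$, put $I_1=[y_0,y_1]$ and $I_i=(y_{i-1},y_i]$ for $2\le i\le n$, and let $p_1,\dots,p_n>0$ with $\sum_i p_i=1$. Let $g(x)=x^r(1-x)^k$ and $f(x)=x^r(1-x)^{m+k}$ on $[0,1]$, and $$h(x)=(1-x)^m\,\frac{r-x(m+k+r)}{r-x(k+r)}\qquad\Big(x\in[0,1],\ x\ne\tfrac{r}{r+k}\Big).$$ For indices $1\le j_1\le j_2\le n$ and $y_*\in[0,1]$ let $\phi_1^*=S_1(f)/S_1(g)$ and $\phi_2^*=S_2(f)/S_2(g)$, where for $j_1<j_2$ $$S_1(u)=\sum_{i=2}^{j_1}u(y_{i-1})p_i+\sum_{i=j_1+1}^{j_2-1}u(y_i)p_i+u(y_*)p_{j_2}+\sum_{i=j_2+1}^{n}u(y_{i-1})p_i,$$ $$S_2(u)=\sum_{i=2}^{j_1-1}u(y_{i-1})p_i+\sum_{i=j_1}^{j_2-1}u(y_i)p_i+u(y_*)p_{j_2}+\sum_{i=j_2+1}^{n}u(y_{i-1})p_i,$$ and for $j_1=j_2$ $$S_1(u)=\sum_{i=2}^{n}u(y_{i-1})p_i,\qquad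 S_2(u)=\sum_{i=2}^{j_2-1}u(y_{i-1})p_i+u(y_*)p_{j_2}+\sum_{i=j_2+1}^{n}u(y_{i-1})p_i .$$ **Theorem.** (a) Let $n\ge 3$. There is exactly one triple $(\phi^*,y_*,y_{**})$ of real numbers for which there are $1\le j_1\le j_2\le n$ with $y_{**}\in\bar I_{j_1}$, $y_*\in\bar I_{j_2}$ ($\bar I_i$ is the closure of $I_i$), $$h(y_{**})=\phi^*=h(y_*),\qquad y_{**}<\frac{r}{r+m+k}<\frac{r}{r+k}<y_*,\qquad \phi^*=\min\{\phi_1^*,\phi_2^*\}.$$ Its first component is the infimum: $$\phi^*=\inf_{x_1\in I_1,\dots,x_n\in I_n}\frac{\sum_{i=1}^n x_i^r(1-x_i)^{m+k}p_i}{\sum_{i=1}^n x_i^r(1-x_i)^{k}p_i}.$$ For all indices $j_1\le j_2$ as above, this infimum is attained by the discrete prior $P=\sum_{i=1}^n p_i\,\delta_{\xi_i}$, where $\xi_1=0$ and, for $i\ge2$: $\xi_i=y_{i-1}$ if $i<j_1$ or $i>j_2$; $\xi_i=y_i$ if $j_1<i<j_2$; if $\phi^*=\phi_1^*$, then $\xi_{j_1}=y_{j_1-1}$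 and, when $j_1<j_2$, $\xi_{j_2}=y_*$; if $\phi^*=\phi_2^*\ne\phi_1^*$, then $\xi_{j_1}=\min\{y_{j_1},y_*\}$ and $\xi_{j_2}=y_*$. That is, $P$ is a probability measure with $\xi_i\in\bar I_i$ for all $i$ (so it is a limit of priors that satisfy the interval constraints), $\int g\,dP>0$, and $\int f\,dP\big/\int g\,dP=\phi^*$. (b) In the degenerate cases $n\in\{1,2\}$ the infimum, taken over the points $x_i\in I_i$ at which the denominator is non-zero, is $0=h(1)=h\big(\tfrac{r}{r+m+k}\big)$, and the quotient tends to $0$ along $x_i=0$ $(i<n)$, $x_n\to1^-$. -/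

import Mathlib

open Set Filter Topology MeasureTheory

noncomputable section

namespace CBI

/-- The likelihood `g(x) = x^r (1-x)^k` (real exponents). -/
def g (k r x : ℝ) : ℝ := x ^ r * (1 - x) ^ k

/-- `f(x) = x^r (1-x)^(m+k)`. -/
def f (m k r x : ℝ) : ℝ := x ^ r * (1 - x) ^ (m + k)

/-- The function `h`; it is only used at points `x ≠ r/(r+k)`. -/
def h (m k r x : ℝ) : ℝ :=
  (1 - x) ^ m * ((r - x * (m + k + r)) / (r - x * (k + r)))

/-- The intervals `I_1 = [y_0, y_1]` and `I_i = (y_{i-1}, y_i]` for `i ≥ 2`. -/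
def I (y : ℕ → ℝ) (i : ℕ) : Set ℝ :=
  if i = 1 then Icc (y 0) (y 1) else Ioc (y (i - 1)) (y i)

/-- The denominator `∑_{i=1}^n g(x_i) p_i` of the objective function. -/
def den (k r : ℝ) (n : ℕ) (p x : ℕ → ℝ) : ℝ :=
  ∑ i ∈ Finset.Icc 1 n, g k r (x i) * p i

/-- The numerator `∑_{i=1}^n f(x_i) p_i` of the objective function. -/
def num (m k r : ℝ) (n : ℕ) (p x : ℕ → ℝ) : ℝ :=
  ∑ i ∈ Finset.Icc 1 n, f m k r (x i) * p i

/-- The objective function. -/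
def objective (m k r : ℝ) (n : ℕ) (p x : ℕ → ℝ) : ℝ :=
  num m k r n p x / den k r n p x

/-- All values of the objective function at feasible points `x_i ∈ I_i` at which it is defined.
(For `n ≥ 3` the denominator never vanishes on feasible points, since `x_2 ∈ (0,1)`.) -/
def values (m k r : ℝ) (n : ℕ) (y p : ℕ → ℝ) : Set ℝ :=
  {v | ∃ x : ℕ → ℝ, (∀ i ∈ Finset.Icc 1 n, x i ∈ I y i) ∧ den k r n p x ≠ 0 ∧
    v = objective m k r n p x}

/-- The sum occurring in the numerator (for `u = f`) and denominator (for `u = g`) of the first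
endpoint-placement value; `ys` stands for `y_*`. -/
def S₁ (u : ℝ → ℝ) (n : ℕ) (y p : ℕ → ℝ) (ys : ℝ) (j₁ j₂ : ℕ) : ℝ :=
  if j₁ < j₂ then
    ∑ i ∈ Finset.Icc 2 j₁, u (y (i - 1)) * p i
      + ∑ i ∈ Finset.Icc (j₁ + 1) (j₂ - 1), u (y i) * p i
      + u ys * p j₂
      + ∑ i ∈ Finset.Icc (j₂ + 1) n, u (y (i - 1)) * p i
  else
    ∑ i ∈ Finset.Icc 2 n, u (y (i - 1)) * p i

/-- The same for the second endpoint-placement value. -/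
def S₂ (u : ℝ → ℝ) (n : ℕ) (y p : ℕ → ℝ) (ys : ℝ) (j₁ j₂ : ℕ) : ℝ :=
  if j₁ < j₂ then
    ∑ i ∈ Finset.Icc 2 (j₁ - 1), u (y (i - 1)) * p i
      + ∑ i ∈ Finset.Icc j₁ (j₂ - 1), u (y i) * p i
      + u ys * p j₂
      + ∑ i ∈ Finset.Icc (j₂ + 1) n, u (y (i - 1)) * p i
  else
    ∑ i ∈ Finset.Icc 2 (j₂ - 1), u (y (i - 1)) * p i
      + u ys * p j₂
      + ∑ i ∈ Finset.Icc (j₂ + 1) n, u (y (i - 1)) * p i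

/-- `φ*_1`. -/
def φ₁ (m k r : ℝ) (n : ℕ) (y p : ℕ → ℝ) (ys : ℝ) (j₁ j₂ : ℕ) : ℝ :=
  S₁ (f m k r) n y p ys j₁ j₂ / S₁ (g k r) n y p ys j₁ j₂

/-- `φ*_2`. -/
def φ₂ (m k r : ℝ) (n : ℕ) (y p : ℕ → ℝ) (ys : ℝ) (j₁ j₂ : ℕ) : ℝ :=
  S₂ (f m k r) n y p ys j₁ j₂ / S₂ (g k r) n y p ys j₁ j₂

/-- The fixed-point system for a triple `(φ, ys, yss)`, standing for `(φ*, y_*, y_**)`,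
with interval indices `j₁, j₂`. -/
structure IsFixedPoint (m k r : ℝ) (n : ℕ) (y p : ℕ → ℝ) (φ ys yss : ℝ) (j₁ j₂ : ℕ) : Prop where
  one_le : 1 ≤ j₁
  le : j₁ ≤ j₂
  le_n : j₂ ≤ n
  h_yss : h m k r yss = φ
  h_ys : h m k r ys = φ
  eq_min : φ = min (φ₁ m k r n y p ys j₁ j₂) (φ₂ m k r n y p ys j₁ j₂)
  yss_lt : yss < r / (r + m + k)
  mid_lt : r / (r + m + k) < r / (r + k)
  lt_ys : r / (r + k) < ys
  yss_mem : yss ∈ closure (I y j₁)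
  ys_mem : ys ∈ closure (I y j₂)

/-- The location at which the conservative prior puts the mass `p_i`, `1 ≤ i ≤ n`. -/
def loc (m k r : ℝ) (n : ℕ) (y p : ℕ → ℝ) (φ ys : ℝ) (j₁ j₂ : ℕ) (i : ℕ) : ℝ :=
  if i = 1 then (if n = 1 then 1 else 0)
  else if i < j₁ ∨ j₂ < i then y (i - 1)
  else if j₁ < i ∧ i < j₂ then y i
  else if φ = φ₁ m k r n y p ys j₁ j₂ then
    (if i = j₁ then y (j₁ - 1) else ys)
  else
    (if i = j₁ then min (y j₁) ys else ys)

/-- The conservative prior: the discrete measure `∑_i p_i δ_{loc i}`. -/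
def prior (m k r : ℝ) (n : ℕ) (y p : ℕ → ℝ) (φ ys : ℝ) (j₁ j₂ : ℕ) : Measure ℝ :=
  ∑ i ∈ Finset.Icc 1 n, ENNReal.ofReal (p i) • Measure.dirac (loc m k r n y p φ ys j₁ j₂ i)

end CBI

end

/-! Where the denominator is positive, the objective is at least `φ` exactly when `∑ gain (x i) * p
i ≥ 0`, with `gain = f - φ g`. This sum separates over the coordinates, so the fractional problem
reduces to minimising one function on each closed cell.

Off the pole `r/(r+k)`, the derivative of `gain` on `(0,1)` has the sign of `(r - x(k+r)) (h x -
φ)`. For `0 < φ < 1`, `h` takes the value `φ` once on `[0, r/(r+m+k))`, at `yss`, and once on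
`(r/(r+k), 1]`, at `ys`; thus `gain` rises up to `yss`, falls up to `ys` and rises again. This fixes
a minimiser in every cell but that of `yss`, where two candidates remain; they give the two
placements (`sum_gain_placement_le_or`).

Hence `φ` is the minimum over the closed box iff it equals `min φ₁ φ₂` at its own critical points
(`IsFixedPoint.isMinLevel`, `IsMinLevel.isFixedPoint`). The minimum exists by compactness and is
unique, and it determines the critical points. The prior always puts its first mass at `0`;
`IsFixedPoint.one_lt` reconciles this with the second placement. For `n ≤ 2` every mass but the last
can sit at `0`, and the quotient degenerates to `(1 - t)^m`. -/

namespace CBI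

/-! ### Elementary properties of `f`, `g` and `gain` -/

/-- The function `f - φ g`, whose weighted sums decide whether the objective exceeds `φ`. -/
noncomputable def gain (m k r φ x : ℝ) : ℝ := f m k r x - φ * g k r x

/-- The factor of the derivative of `gain` that determines its sign on `(0,1)`. -/
noncomputable def slope (m k r φ x : ℝ) : ℝ :=
  (1 - x) ^ m * (r - x * (m + k + r)) - φ * (r - x * (k + r))

lemma continuous_g {k r : ℝ} (hk : 0 < k) (hr : 0 < r) : Continuous (g k r) := by
  unfold g
  exact (continuous_id.rpow_const fun _ => Or.inr hr.le).mul
    ((continuous_const.sub continuous_id).rpow_const fun _ => Or.inr hk.le)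

lemma continuous_f {m k r : ℝ} (hm : 0 < m) (hk : 0 < k) (hr : 0 < r) :
    Continuous (f m k r) := by
  unfold f
  exact (continuous_id.rpow_const fun _ => Or.inr hr.le).mul
    ((continuous_const.sub continuous_id).rpow_const fun _ => Or.inr (by positivity))

lemma continuous_gain {m k r : ℝ} (hm : 0 < m) (hk : 0 < k) (hr : 0 < r) (φ : ℝ) :
    Continuous (gain m k r φ) :=
  (continuous_f hm hk hr).sub (continuous_const.mul (continuous_g hk hr))

lemma continuous_slope {m : ℝ} (hm : 0 < m) (k r φ : ℝ) : Continuous (slope m k r φ) := by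
  unfold slope
  exact (((continuous_const.sub continuous_id).rpow_const fun _ => Or.inr hm.le).mul
    (by fun_prop)).sub (by fun_prop)

lemma g_zero {k r : ℝ} (hr : 0 < r) : g k r 0 = 0 := by
  simp [g, Real.zero_rpow hr.ne']

lemma f_zero {m k r : ℝ} (hr : 0 < r) : f m k r 0 = 0 := by
  simp [f, Real.zero_rpow hr.ne']

lemma g_nonneg {k r x : ℝ} (hx : x ∈ Icc (0 : ℝ) 1) : 0 ≤ g k r x :=
  mul_nonneg (Real.rpow_nonneg hx.1 _) (Real.rpow_nonneg (by linarith [hx.2]) _)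

lemma g_pos {k r x : ℝ} (hx : x ∈ Ioo (0 : ℝ) 1) : 0 < g k r x :=
  mul_pos (Real.rpow_pos_of_pos hx.1 _) (Real.rpow_pos_of_pos (by linarith [hx.2]) _)

lemma f_eq {m k r x : ℝ} (hm : 0 < m) (hk : 0 < k) (hx : x ≤ 1) :
    f m k r x = (1 - x) ^ m * g k r x := by
  rw [f, g, Real.rpow_add_of_nonneg (by linarith) hm.le hk.le]
  ring

lemma f_nonneg {m k r x : ℝ} (hx : x ∈ Icc (0 : ℝ) 1) : 0 ≤ f m k r x :=
  mul_nonneg (Real.rpow_nonneg hx.1 _) (Real.rpow_nonneg (by linarith [hx.2]) _)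

lemma f_pos {m k r x : ℝ} (hx : x ∈ Ioo (0 : ℝ) 1) : 0 < f m k r x :=
  mul_pos (Real.rpow_pos_of_pos hx.1 _) (Real.rpow_pos_of_pos (by linarith [hx.2]) _)

lemma f_le_g {m k r x : ℝ} (hm : 0 < m) (hk : 0 < k) (hx : x ∈ Icc (0 : ℝ) 1) :
    f m k r x ≤ g k r x := by
  rw [f_eq hm hk hx.2]
  exact mul_le_of_le_one_left (g_nonneg hx)
    (Real.rpow_le_one (by linarith [hx.2]) (by linarith [hx.1]) hm.le)

lemma f_lt_g {m k r x : ℝ} (hm : 0 < m) (hk : 0 < k) (hx : x ∈ Ioo (0 : ℝ) 1) :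
    f m k r x < g k r x := by
  rw [f_eq hm hk hx.2.le]
  exact mul_lt_of_lt_one_left (g_pos hx)
    (Real.rpow_lt_one (by linarith [hx.2]) (by linarith [hx.1]) hm)

lemma gain_zero {m k r φ : ℝ} (hr : 0 < r) : gain m k r φ 0 = 0 := by
  simp [gain, f_zero hr, g_zero hr]

/-- Once `gain` is negative it stays nonpositive up to `1`. -/
lemma gain_nonpos_of_neg {m k r φ c x : ℝ} (hm : 0 < m) (hk : 0 < k) (hc : 0 ≤ c) (hcx : c ≤ x)
    (hx : x ≤ 1) (hneg : gain m k r φ c < 0) : gain m k r φ x ≤ 0 := by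
  -- The factor multiplying `g ≥ 0` decreases in `z`, so it cannot become positive again.
  have key : ∀ z ≤ (1 : ℝ), gain m k r φ z = ((1 - z) ^ m - φ) * g k r z := fun z hz => by
    rw [gain, f_eq hm hk hz]; ring
  rw [key c (hcx.trans hx)] at hneg
  rw [key x hx]
  have h1 : (1 - c) ^ m - φ < 0 := by
    by_contra! hcon
    exact absurd hneg (not_lt.2 (mul_nonneg hcon (g_nonneg ⟨hc, hcx.trans hx⟩)))
  have h2 : (1 - x) ^ m ≤ (1 - c) ^ m :=
    Real.rpow_le_rpow (by linarith) (by linarith) hm.le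
  exact mul_nonpos_of_nonpos_of_nonneg (by linarith) (g_nonneg ⟨hc.trans hcx, hx⟩)

lemma hasDerivAt_gain {m k r φ x : ℝ} (hx : x ∈ Ioo (0 : ℝ) 1) :
    HasDerivAt (gain m k r φ) (x ^ (r - 1) * (1 - x) ^ (k - 1) * slope m k r φ x) x := by
  have hx0 : 0 < x := hx.1
  have hx1 : 0 < 1 - x := by linarith [hx.2]
  have dx : HasDerivAt (fun z : ℝ => z ^ r) (1 * r * x ^ (r - 1)) x :=
    (hasDerivAt_id x).rpow_const (Or.inl hx0.ne')
  have d1 : ∀ s : ℝ, HasDerivAt (fun z : ℝ => (1 - z) ^ s) (-1 * s * (1 - x) ^ (s - 1)) x :=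
    fun s => ((hasDerivAt_id x).const_sub 1).rpow_const (Or.inl hx1.ne')
  have key := (dx.mul (d1 (m + k))).sub ((dx.mul (d1 k)).const_mul φ)
  refine HasDerivAt.congr_deriv key ?_
  -- All powers are reduced to `x^(r-1)`, `(1-x)^(k-1)` and `(1-x)^m`, so that the rest is
  -- polynomial.
  have e1 : x ^ r = x ^ (r - 1) * x := by
    rw [← Real.rpow_add_one hx0.ne']; ring_nf
  have e2 : (1 - x) ^ k = (1 - x) ^ (k - 1) * (1 - x) := by
    rw [← Real.rpow_add_one hx1.ne']; ring_nf
  have e3 : (1 - x) ^ (m + k) = (1 - x) ^ m * ((1 - x) ^ (k - 1) * (1 - x)) := by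
    rw [Real.rpow_add hx1, e2]
  have e4 : (1 - x) ^ (m + k - 1) = (1 - x) ^ m * (1 - x) ^ (k - 1) := by
    rw [← Real.rpow_add hx1]; ring_nf
  rw [e3, e4, e2, e1, slope]
  ring

/-! ### Monotonicity of `h` and the two critical points -/

/-- The first factor changes sign at the pole of `h`. This is why `h`, decreasing on both sides,
produces a maximum of `gain` at `yss` but a minimum at `ys`. -/
lemma slope_eq {m k r φ x : ℝ} (hx : r - x * (k + r) ≠ 0) :
    slope m k r φ x = (r - x * (k + r)) * (h m k r x - φ) := by
  rw [slope, h]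
  field_simp

/-- `h` is `(1-x)^m` times a Möbius quotient that decreases on each side of its pole. `hside` puts
both points on the same side, and `hpos` lets the two monotonicities be multiplied. -/
lemma h_lt_h {m k r x x' : ℝ} (hm : 0 < m) (hr : 0 < r) (hxx : x < x') (hx' : x' ≤ 1)
    (hside : 0 < (r - x * (k + r)) * (r - x' * (k + r)))
    (hpos : 0 ≤ (r - x' * (m + k + r)) / (r - x' * (k + r))) :
    h m k r x' < h m k r x := by
  have hne : r - x * (k + r) ≠ 0 := left_ne_zero_of_mul hside.ne'
  have hne' : r - x' * (k + r) ≠ 0 := right_ne_zero_of_mul hside.ne'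
  have hw : (r - x' * (m + k + r)) / (r - x' * (k + r))
      < (r - x * (m + k + r)) / (r - x * (k + r)) := by
    rw [← sub_pos, div_sub_div _ _ hne hne']
    refine div_pos ?_ hside
    -- This is the numerator of the difference of the two quotients.
    have : 0 < r * m * (x' - x) := by have := sub_pos.2 hxx; positivity
    linarith
  have hA : (1 - x') ^ m ≤ (1 - x) ^ m :=
    Real.rpow_le_rpow (by linarith) (by linarith) hm.le
  exact (mul_le_mul_of_nonneg_right hA hpos).trans_lt
    (mul_lt_mul_of_pos_left hw (Real.rpow_pos_of_pos (by linarith) _))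

lemma lt_div_left {m k r x : ℝ} (hm : 0 < m) (hk : 0 < k) (hr : 0 < r)
    (hx : x < r / (r + m + k)) : 0 < r - x * (m + k + r) := by
  rw [lt_div_iff₀ (by positivity)] at hx
  linarith

lemma div_lt_div_mid {m k r : ℝ} (hm : 0 < m) (hk : 0 < k) (hr : 0 < r) :
    r / (r + m + k) < r / (r + k) :=
  div_lt_div_of_pos_left hr (by positivity) (by linarith)

lemma lt_div_mid {k r x : ℝ} (hk : 0 < k) (hr : 0 < r) :
    x < r / (r + k) ↔ 0 < r - x * (k + r) := by
  rw [lt_div_iff₀ (by positivity), sub_pos, add_comm]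

lemma div_mid_lt {k r x : ℝ} (hk : 0 < k) (hr : 0 < r) :
    r / (r + k) < x ↔ r - x * (k + r) < 0 := by
  rw [div_lt_iff₀ (by positivity), sub_neg, add_comm]

lemma h_lt_h_left {m k r x x' : ℝ} (hm : 0 < m) (hk : 0 < k) (hr : 0 < r) (hxx : x < x')
    (hx' : x' < r / (r + m + k)) : h m k r x' < h m k r x := by
  have hb := hx'.trans (div_lt_div_mid hm hk hr)
  have h1 := (lt_div_mid hk hr).1 hb
  have h1' : r / (r + m + k) ≤ 1 := (div_le_one (by positivity)).2 (by linarith)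
  exact h_lt_h hm hr hxx (by linarith) (mul_pos ((lt_div_mid hk hr).1 (hxx.trans hb)) h1)
    (div_nonneg (lt_div_left hm hk hr hx').le h1.le)

lemma h_lt_h_right {m k r x x' : ℝ} (hm : 0 < m) (hk : 0 < k) (hr : 0 < r) (hxx : x < x')
    (hx : r / (r + k) < x) (hx' : x' ≤ 1) : h m k r x' < h m k r x := by
  have h1 := (div_mid_lt hk hr).1 hx
  have h2 := (div_mid_lt hk hr).1 (hx.trans hxx)
  have h0 : 0 < r / (r + k) := by positivity
  refine h_lt_h hm hr hxx hx' (mul_pos_of_neg_of_neg h1 h2)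
    (div_nonneg_of_nonpos ?_ h2.le)
  have : 0 < x' * m := mul_pos (by linarith) hm
  linarith

lemma h_pos_left {m k r x : ℝ} (hm : 0 < m) (hk : 0 < k) (hr : 0 < r)
    (hx : x < r / (r + m + k)) : 0 < h m k r x := by
  have h1' : r / (r + m + k) ≤ 1 := (div_le_one (by positivity)).2 (by linarith)
  exact mul_pos (Real.rpow_pos_of_pos (by linarith) _)
    (div_pos (lt_div_left hm hk hr hx) ((lt_div_mid hk hr).1 (hx.trans (div_lt_div_mid hm hk hr))))

/-- `yss` and `ys` are the two critical points of `gain` at level `φ`. -/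
structure IsCriticalPair (m k r φ ys yss : ℝ) : Prop where
  nonneg : 0 ≤ yss
  le_one : ys ≤ 1
  h_yss : h m k r yss = φ
  h_ys : h m k r ys = φ
  yss_lt : yss < r / (r + m + k)
  lt_ys : r / (r + k) < ys

/-- The intermediate value theorem is applied to `slope`, which has no pole: it is positive at `0`
because `φ < 1`, negative at `r/(r+m+k)` and `r/(r+k)`, and positive at `1`. -/
lemma exists_isCriticalPair {m k r φ : ℝ} (hm : 0 < m) (hk : 0 < k) (hr : 0 < r)
    (h0 : 0 < φ) (h1 : φ < 1) : ∃ ys yss, IsCriticalPair m k r φ ys yss := by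
  have ha : 0 < r / (r + m + k) := by positivity
  have hab := div_lt_div_mid hm hk hr
  have hb1 : r / (r + k) < 1 := (div_lt_one (by positivity)).2 (by linarith)
  have s0 : 0 < slope m k r φ 0 := by
    simp only [slope, sub_zero, Real.one_rpow, zero_mul]; nlinarith
  have sa : slope m k r φ (r / (r + m + k)) < 0 := by
    have e : r - r / (r + m + k) * (m + k + r) = 0 := by field_simp; ring
    have := (lt_div_mid hk hr).1 hab
    rw [slope, e, mul_zero, zero_sub, neg_lt_zero]
    positivity
  have sb : slope m k r φ (r / (r + k)) < 0 := by
    have e : r - r / (r + k) * (k + r) = 0 := by field_simp; ring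
    have e' : r - r / (r + k) * (m + k + r) < 0 := by
      have : 0 < r / (r + k) * m := by positivity
      linarith
    rw [slope, e, mul_zero, sub_zero]
    exact mul_neg_of_pos_of_neg (Real.rpow_pos_of_pos (by linarith) _) e'
  have s1 : 0 < slope m k r φ 1 := by
    simp only [slope, sub_self, Real.zero_rpow hm.ne', zero_mul]
    have : 0 < φ * k := by positivity
    linarith
  obtain ⟨yss, hyss, e1⟩ := intermediate_value_Ioo' ha.le (continuous_slope hm k r φ).continuousOn
    (show (0 : ℝ) ∈ Ioo _ _ from ⟨sa, s0⟩)
  obtain ⟨ys, hys, e2⟩ := intermediate_value_Ioo hb1.le (continuous_slope hm k r φ).continuousOn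
    (show (0 : ℝ) ∈ Ioo _ _ from ⟨sb, s1⟩)
  have n1 := (lt_div_mid hk hr).1 (hyss.2.trans hab)
  have n2 := (div_mid_lt hk hr).1 hys.1
  rw [slope_eq n1.ne', mul_eq_zero, or_iff_right n1.ne', sub_eq_zero] at e1
  rw [slope_eq n2.ne, mul_eq_zero, or_iff_right n2.ne, sub_eq_zero] at e2
  exact ⟨ys, yss, hyss.1.le, hys.2.le, e1, e2, hyss.2, hys.1⟩

namespace IsCriticalPair

variable {m k r φ ys yss : ℝ}

lemma level_pos (c : IsCriticalPair m k r φ ys yss) (hm : 0 < m) (hk : 0 < k) (hr : 0 < r) :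
    0 < φ :=
  c.h_yss ▸ h_pos_left hm hk hr c.yss_lt

lemma unique (c : IsCriticalPair m k r φ ys yss) {ys' yss' : ℝ}
    (c' : IsCriticalPair m k r φ ys' yss') (hm : 0 < m) (hk : 0 < k) (hr : 0 < r) :
    ys' = ys ∧ yss' = yss := by
  constructor
  · rcases lt_trichotomy ys ys' with hlt | heq | hlt
    · have := h_lt_h_right hm hk hr hlt c.lt_ys c'.le_one
      linarith [c.h_ys, c'.h_ys]
    · exact heq.symm
    · have := h_lt_h_right hm hk hr hlt c'.lt_ys c.le_one
      linarith [c.h_ys, c'.h_ys]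
  · rcases lt_trichotomy yss yss' with hlt | heq | hlt
    · have := h_lt_h_left hm hk hr hlt c'.yss_lt
      linarith [c.h_yss, c'.h_yss]
    · exact heq.symm
    · have := h_lt_h_left hm hk hr hlt c.yss_lt
      linarith [c.h_yss, c'.h_yss]

lemma lt (c : IsCriticalPair m k r φ ys yss) (hm : 0 < m) (hk : 0 < k) (hr : 0 < r) :
    yss < ys :=
  c.yss_lt.trans ((div_lt_div_mid hm hk hr).trans c.lt_ys)

/-! ### Shape of `gain`: rising, falling, rising -/

lemma slope_nonneg_left (c : IsCriticalPair m k r φ ys yss) (hm : 0 < m) (hk : 0 < k)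
    (hr : 0 < r) {x : ℝ} (hx : x < yss) : 0 ≤ slope m k r φ x := by
  have n := (lt_div_mid hk hr).1 ((hx.trans c.yss_lt).trans (div_lt_div_mid hm hk hr))
  rw [slope_eq n.ne']
  have := h_lt_h_left hm hk hr hx c.yss_lt
  rw [c.h_yss] at this
  exact mul_nonneg n.le (by linarith)

lemma slope_nonneg_right (c : IsCriticalPair m k r φ ys yss) (hm : 0 < m) (hk : 0 < k)
    (hr : 0 < r) {x : ℝ} (hx : ys < x) (hx1 : x ≤ 1) : 0 ≤ slope m k r φ x := by
  have n := (div_mid_lt hk hr).1 (c.lt_ys.trans hx)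
  rw [slope_eq n.ne]
  have := h_lt_h_right hm hk hr hx c.lt_ys hx1
  rw [c.h_ys] at this
  exact mul_nonneg_of_nonpos_of_nonpos n.le (by linarith)

lemma slope_nonpos_mid (c : IsCriticalPair m k r φ ys yss) (hm : 0 < m) (hk : 0 < k)
    (hr : 0 < r) {x : ℝ} (hx : yss < x) (hx' : x < ys) : slope m k r φ x ≤ 0 := by
  have hφ := c.level_pos hm hk hr
  rcases lt_or_ge x (r / (r + m + k)) with hxa | hxa
  · have n := (lt_div_mid hk hr).1 (hxa.trans (div_lt_div_mid hm hk hr))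
    rw [slope_eq n.ne']
    have := h_lt_h_left hm hk hr hx hxa
    rw [c.h_yss] at this
    exact mul_nonpos_of_nonneg_of_nonpos n.le (by linarith)
  -- Between the two thresholds `h` is of no use (its pole is there), but both terms of `slope` are
  -- nonpositive.
  rcases le_or_gt x (r / (r + k)) with hxb | hxb
  · rw [div_le_iff₀ (by positivity)] at hxa
    rw [le_div_iff₀ (by positivity)] at hxb
    have h1 : (1 - x) ^ m * (r - x * (m + k + r)) ≤ 0 :=
      mul_nonpos_of_nonneg_of_nonpos (Real.rpow_nonneg (by linarith [c.le_one]) _) (by linarith)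
    have h2 : 0 ≤ φ * (r - x * (k + r)) := mul_nonneg hφ.le (by linarith)
    rw [slope]
    linarith
  · have n := (div_mid_lt hk hr).1 hxb
    rw [slope_eq n.ne]
    have := h_lt_h_right hm hk hr hx' hxb c.le_one
    rw [c.h_ys] at this
    exact mul_nonpos_of_nonpos_of_nonneg n.le (by linarith)

lemma weight_nonneg {x : ℝ} (hx : x ∈ Ioo (0 : ℝ) 1) :
    0 ≤ x ^ (r - 1) * (1 - x) ^ (k - 1) :=
  mul_nonneg (Real.rpow_nonneg hx.1.le _) (Real.rpow_nonneg (by linarith [hx.2]) _)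

lemma monotoneOn_left (c : IsCriticalPair m k r φ ys yss) (hm : 0 < m) (hk : 0 < k)
    (hr : 0 < r) : MonotoneOn (gain m k r φ) (Icc 0 yss) := by
  have hlt := c.lt hm hk hr
  have hI : ∀ x ∈ Ioo 0 yss, x ∈ Ioo (0 : ℝ) 1 := fun x hx =>
    ⟨hx.1, by linarith [hx.2, c.le_one]⟩
  refine monotoneOn_of_hasDerivWithinAt_nonneg (convex_Icc _ _)
    (continuous_gain hm hk hr φ).continuousOn
    (fun x hx => (hasDerivAt_gain (hI x (by simpa using hx))).hasDerivWithinAt) fun x hx => ?_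
  rw [interior_Icc] at hx
  exact mul_nonneg (weight_nonneg (hI x hx)) (c.slope_nonneg_left hm hk hr hx.2)

lemma antitoneOn_mid (c : IsCriticalPair m k r φ ys yss) (hm : 0 < m) (hk : 0 < k)
    (hr : 0 < r) : AntitoneOn (gain m k r φ) (Icc yss ys) := by
  have hI : ∀ x ∈ Ioo yss ys, x ∈ Ioo (0 : ℝ) 1 := fun x hx =>
    ⟨by linarith [hx.1, c.nonneg], by linarith [hx.2, c.le_one]⟩
  refine antitoneOn_of_hasDerivWithinAt_nonpos (convex_Icc _ _)
    (continuous_gain hm hk hr φ).continuousOn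
    (fun x hx => (hasDerivAt_gain (hI x (by simpa using hx))).hasDerivWithinAt) fun x hx => ?_
  rw [interior_Icc] at hx
  exact mul_nonpos_of_nonneg_of_nonpos (weight_nonneg (hI x hx))
    (c.slope_nonpos_mid hm hk hr hx.1 hx.2)

lemma monotoneOn_right (c : IsCriticalPair m k r φ ys yss) (hm : 0 < m) (hk : 0 < k)
    (hr : 0 < r) : MonotoneOn (gain m k r φ) (Icc ys 1) := by
  have hlt := c.lt hm hk hr
  have hI : ∀ x ∈ Ioo ys 1, x ∈ Ioo (0 : ℝ) 1 := fun x hx =>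
    ⟨by linarith [hx.1, c.nonneg], hx.2⟩
  refine monotoneOn_of_hasDerivWithinAt_nonneg (convex_Icc _ _)
    (continuous_gain hm hk hr φ).continuousOn
    (fun x hx => (hasDerivAt_gain (hI x (by simpa using hx))).hasDerivWithinAt) fun x hx => ?_
  rw [interior_Icc] at hx
  exact mul_nonneg (weight_nonneg (hI x hx)) (c.slope_nonneg_right hm hk hr hx.1 hx.2.le)

end IsCriticalPair
end CBI

namespace CBI

/-! ### Partitions and the box of closed cells -/

/-- `y` restricted to `0, …, n` is a partition of `[0,1]`. -/
structure IsPartition (n : ℕ) (y : ℕ → ℝ) : Prop where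
  zero : y 0 = 0
  last : y n = 1
  lt_succ : ∀ i < n, y i < y (i + 1)

namespace IsPartition

variable {n : ℕ} {y : ℕ → ℝ}

lemma mono (hy : IsPartition n y) {i j : ℕ} (hij : i ≤ j) (hj : j ≤ n) : y i ≤ y j := by
  induction j, hij using Nat.le_induction with
  | base => exact le_rfl
  | succ j _ ih => exact (ih (by omega)).trans (hy.lt_succ j (by omega)).le

lemma strictMono (hy : IsPartition n y) {i j : ℕ} (hij : i < j) (hj : j ≤ n) : y i < y j :=
  (hy.lt_succ i (by omega)).trans_le (hy.mono hij hj)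

lemma mem_unit (hy : IsPartition n y) {i : ℕ} (hi : i ≤ n) : y i ∈ Icc (0 : ℝ) 1 :=
  ⟨hy.zero ▸ hy.mono (Nat.zero_le i) hi, hy.last ▸ hy.mono hi le_rfl⟩

lemma closure_I (hy : IsPartition n y) {i : ℕ} (hi : i ∈ Finset.Icc 1 n) :
    closure (I y i) = Icc (y (i - 1)) (y i) := by
  rw [Finset.mem_Icc] at hi
  unfold I
  split_ifs with h1
  · subst h1; exact isClosed_Icc.closure_eq
  · exact closure_Ioc (hy.strictMono (by omega) hi.2).ne

/-- The smallest admissible index is chosen; its minimality later orders the cells of `yss` and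
`ys`. -/
lemma exists_mem_cell (hy : IsPartition n y) {t : ℝ} (h0 : 0 ≤ t) (h1 : t ≤ 1) :
    ∃ j, 1 ≤ j ∧ j ≤ n ∧ t ∈ Icc (y (j - 1)) (y j) ∧ ∀ i, 1 ≤ i → t ≤ y i → j ≤ i := by
  classical
  have hn : 1 ≤ n := by
    rcases Nat.eq_zero_or_pos n with rfl | hn
    · have := hy.last; rw [hy.zero] at this; norm_num at this
    · exact hn
  have hex : ∃ j, 1 ≤ j ∧ t ≤ y j := ⟨n, hn, hy.last ▸ h1⟩
  obtain ⟨hj1, hj⟩ := Nat.find_spec hex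
  refine ⟨Nat.find hex, hj1, Nat.find_min' hex ⟨hn, hy.last ▸ h1⟩, ⟨?_, hj⟩,
    fun i hi hti => Nat.find_min' hex ⟨hi, hti⟩⟩
  rcases Nat.eq_or_lt_of_le hj1 with he | hlt
  · rw [← he]; simpa [hy.zero] using h0
  · have := Nat.find_min hex (m := Nat.find hex - 1) (by omega)
    by_contra! hcon
    exact this ⟨by omega, hcon.le⟩

end IsPartition

/-- The points whose coordinates lie in the closed cells of the partition. -/
def box (n : ℕ) (y : ℕ → ℝ) : Set (ℕ → ℝ) :=
  Set.pi (Finset.Icc 1 n : Finset ℕ) fun i => Icc (y (i - 1)) (y i)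

lemma mem_box {n : ℕ} {y x : ℕ → ℝ} :
    x ∈ box n y ↔ ∀ i ∈ Finset.Icc 1 n, x i ∈ Icc (y (i - 1)) (y i) := by
  simp only [box, Set.mem_pi, Finset.mem_coe]

section Box

variable {n : ℕ} {y x : ℕ → ℝ}

lemma mem_unit_of_mem_box (hy : IsPartition n y) (hx : x ∈ box n y) {i : ℕ}
    (hi : i ∈ Finset.Icc 1 n) : x i ∈ Icc (0 : ℝ) 1 := by
  have hi' := Finset.mem_Icc.1 hi
  have := mem_box.1 hx i hi
  exact ⟨(hy.mem_unit (by omega)).1.trans this.1, this.2.trans (hy.mem_unit hi'.2).2⟩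

/-- Here `n ≥ 3` enters: the second closed cell avoids both zeros of `g`, which makes the
denominator positive and the level lie strictly between `0` and `1`. -/
lemma two_mem_Ioo_of_mem_box (hy : IsPartition n y) (hn : 3 ≤ n) (hx : x ∈ box n y) :
    x 2 ∈ Ioo (0 : ℝ) 1 := by
  have := mem_box.1 hx 2 (Finset.mem_Icc.2 ⟨by omega, by omega⟩)
  have h1 := hy.strictMono (i := 0) (j := 1) (by omega) (by omega)
  have h2 := hy.strictMono (i := 2) (j := n) (by omega) le_rfl
  rw [hy.zero] at h1
  rw [hy.last] at h2
  exact ⟨h1.trans_le this.1, this.2.trans_lt h2⟩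

variable {m k r : ℝ} {p : ℕ → ℝ}

lemma den_pos (hy : IsPartition n y) (hp : ∀ i ∈ Finset.Icc 1 n, 0 < p i) (hn : 3 ≤ n)
    (hx : x ∈ box n y) : 0 < den k r n p x := by
  have h2 : 2 ∈ Finset.Icc 1 n := Finset.mem_Icc.2 ⟨by omega, by omega⟩
  exact Finset.sum_pos' (fun i hi => mul_nonneg (g_nonneg (mem_unit_of_mem_box hy hx hi))
    (hp i hi).le) ⟨2, h2, mul_pos (g_pos (two_mem_Ioo_of_mem_box hy hn hx)) (hp 2 h2)⟩

lemma num_pos (hy : IsPartition n y) (hp : ∀ i ∈ Finset.Icc 1 n, 0 < p i) (hn : 3 ≤ n)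
    (hx : x ∈ box n y) : 0 < num m k r n p x := by
  have h2 : 2 ∈ Finset.Icc 1 n := Finset.mem_Icc.2 ⟨by omega, by omega⟩
  exact Finset.sum_pos' (fun i hi => mul_nonneg (f_nonneg (mem_unit_of_mem_box hy hx hi))
    (hp i hi).le) ⟨2, h2, mul_pos (f_pos (two_mem_Ioo_of_mem_box hy hn hx)) (hp 2 h2)⟩

lemma num_lt_den (hm : 0 < m) (hk : 0 < k) (hy : IsPartition n y)
    (hp : ∀ i ∈ Finset.Icc 1 n, 0 < p i) (hn : 3 ≤ n)
    (hx : x ∈ box n y) : num m k r n p x < den k r n p x := by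
  have h2 : 2 ∈ Finset.Icc 1 n := Finset.mem_Icc.2 ⟨by omega, by omega⟩
  exact Finset.sum_lt_sum (fun i hi => mul_le_mul_of_nonneg_right
    (f_le_g hm hk (mem_unit_of_mem_box hy hx hi)) (hp i hi).le)
    ⟨2, h2, mul_lt_mul_of_pos_right (f_lt_g hm hk (two_mem_Ioo_of_mem_box hy hn hx)) (hp 2 h2)⟩

lemma sum_gain (m k r φ : ℝ) (n : ℕ) (p x : ℕ → ℝ) :
    ∑ i ∈ Finset.Icc 1 n, gain m k r φ (x i) * p i = num m k r n p x - φ * den k r n p x := by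
  simp only [num, den, gain, Finset.mul_sum, ← Finset.sum_sub_distrib]
  exact Finset.sum_congr rfl fun i _ => by ring

lemma continuous_num (hm : 0 < m) (hk : 0 < k) (hr : 0 < r) : Continuous (num m k r n p) :=
  continuous_finsetSum _ fun i _ =>
    ((continuous_f hm hk hr).comp (continuous_apply i)).mul continuous_const

lemma continuous_den (hk : 0 < k) (hr : 0 < r) : Continuous (den k r n p) :=
  continuous_finsetSum _ fun i _ =>
    ((continuous_g hk hr).comp (continuous_apply i)).mul continuous_const

end Box

/-! ### The minimal level -/

/-- `φ` is the minimum of the objective function over the box. -/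
structure IsMinLevel (m k r : ℝ) (n : ℕ) (y p : ℕ → ℝ) (φ : ℝ) : Prop where
  le : ∀ x ∈ box n y, φ * den k r n p x ≤ num m k r n p x
  attained : ∃ x ∈ box n y, num m k r n p x = φ * den k r n p x

section MinLevel

variable {m k r φ : ℝ} {n : ℕ} {y p : ℕ → ℝ}

lemma exists_isMinLevel (hm : 0 < m) (hk : 0 < k) (hr : 0 < r) (hy : IsPartition n y)
    (hp : ∀ i ∈ Finset.Icc 1 n, 0 < p i) (hn : 3 ≤ n) : ∃ φ, IsMinLevel m k r n y p φ := by
  classical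
  -- The box leaves coordinates outside `1, …, n` free, so it is not compact. Truncating the indices
  -- confines those coordinates to single points without affecting the objective.
  have hcomp : IsCompact (univ.pi fun i : ℕ => Icc (y (min (i - 1) n)) (y (min i n))) :=
    isCompact_univ_pi fun _ => isCompact_Icc
  set K := univ.pi fun i : ℕ => Icc (y (min (i - 1) n)) (y (min i n)) with hK
  have hsub : K ⊆ box n y := fun x hx => mem_box.2 fun i hi => by
    have hi' := Finset.mem_Icc.1 hi
    have : x i ∈ Icc (y (min (i - 1) n)) (y (min i n)) := hx i (mem_univ i)
    rwa [min_eq_left hi'.2, min_eq_left (by omega)] at this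
  have hne : K.Nonempty := ⟨fun i => y (min i n), fun i _ =>
    ⟨hy.mono (by omega) (by omega), le_rfl⟩⟩
  obtain ⟨x₀, hx₀, hmin⟩ := hcomp.exists_isMinOn hne
    ((continuous_num (p := p) hm hk hr).continuousOn.div (continuous_den hk hr).continuousOn
      fun x hx => (den_pos hy hp hn (hsub hx)).ne')
  refine ⟨num m k r n p x₀ / den k r n p x₀, fun x hx => ?_, x₀, hsub hx₀, ?_⟩
  · let x' : ℕ → ℝ := fun i => if i ∈ Finset.Icc 1 n then x i else y (min i n)
    have hx' : x' ∈ K := fun i _ => by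
      by_cases hi : i ∈ Finset.Icc 1 n
      · have hi' := Finset.mem_Icc.1 hi
        have := mem_box.1 hx i hi
        simp only [x', if_pos hi]
        rwa [min_eq_left hi'.2, min_eq_left (by omega)]
      · simp only [x', if_neg hi]
        exact ⟨hy.mono (by omega) (by omega), le_rfl⟩
    have e1 : num m k r n p x' = num m k r n p x :=
      Finset.sum_congr rfl fun i hi => by simp only [x', if_pos hi]
    have e2 : den k r n p x' = den k r n p x :=
      Finset.sum_congr rfl fun i hi => by simp only [x', if_pos hi]
    have := hmin hx'
    simp only [mem_ofPred_eq, Pi.div_apply] at this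
    rw [e1, e2] at this
    exact (le_div_iff₀ (den_pos hy hp hn hx)).1 this
  · exact (div_mul_cancel₀ _ (den_pos hy hp hn (hsub hx₀)).ne').symm

namespace IsMinLevel

lemma unique (hφ : IsMinLevel m k r n y p φ) {φ' : ℝ} (hφ' : IsMinLevel m k r n y p φ')
    (hy : IsPartition n y) (hp : ∀ i ∈ Finset.Icc 1 n, 0 < p i) (hn : 3 ≤ n) : φ' = φ := by
  obtain ⟨x, hx, e⟩ := hφ.attained
  obtain ⟨x', hx', e'⟩ := hφ'.attained
  have h1 := hφ'.le x hx
  have h2 := hφ.le x' hx'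
  rw [e] at h1
  rw [e'] at h2
  exact le_antisymm (le_of_mul_le_mul_right h1 (den_pos hy hp hn hx))
    (le_of_mul_le_mul_right h2 (den_pos hy hp hn hx'))

lemma pos (hφ : IsMinLevel m k r n y p φ)
    (hy : IsPartition n y) (hp : ∀ i ∈ Finset.Icc 1 n, 0 < p i) (hn : 3 ≤ n) : 0 < φ := by
  obtain ⟨x, hx, e⟩ := hφ.attained
  exact pos_of_mul_pos_left (e ▸ num_pos hy hp hn hx) (den_pos hy hp hn hx).le

lemma lt_one (hφ : IsMinLevel m k r n y p φ) (hm : 0 < m) (hk : 0 < k)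
    (hy : IsPartition n y) (hp : ∀ i ∈ Finset.Icc 1 n, 0 < p i) (hn : 3 ≤ n) : φ < 1 := by
  obtain ⟨x, hx, e⟩ := hφ.attained
  have h1 := num_lt_den (r := r) hm hk hy hp hn hx
  rw [e] at h1
  exact lt_of_mul_lt_mul_right (by simpa using h1) (den_pos (k := k) (r := r) hy hp hn hx).le

/-- The half-open cells are dense in the box, and a lower bound, once cleared of denominators, is a
closed condition; so it passes to the minimiser even if that point is not feasible. -/
lemma isGLB (hφ : IsMinLevel m k r n y p φ) (hm : 0 < m) (hk : 0 < k) (hr : 0 < r)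
    (hy : IsPartition n y) (hp : ∀ i ∈ Finset.Icc 1 n, 0 < p i) (hn : 3 ≤ n) :
    IsGLB (values m k r n y p) φ := by
  have hclos : closure (Set.pi (Finset.Icc 1 n : Finset ℕ) (I y)) = box n y := by
    rw [closure_pi_set]
    exact Set.pi_congr rfl fun i hi => hy.closure_I hi
  constructor
  · rintro v ⟨x, hx, -, rfl⟩
    have hx' : x ∈ box n y := hclos ▸ subset_closure hx
    exact (le_div_iff₀ (den_pos hy hp hn hx')).2 (hφ.le x hx')
  · intro b hb
    have hcl : IsClosed {x : ℕ → ℝ | b * den k r n p x ≤ num m k r n p x} :=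
      isClosed_le (continuous_const.mul (continuous_den hk hr)) (continuous_num hm hk hr)
    have hsub : box n y ⊆ {x : ℕ → ℝ | b * den k r n p x ≤ num m k r n p x} := by
      rw [← hclos]
      refine closure_minimal (fun x hx => ?_) hcl
      have hd := den_pos (k := k) (r := r) hy hp hn (hclos ▸ subset_closure hx)
      exact (le_div_iff₀ hd).1 (hb ⟨x, hx, hd.ne', rfl⟩)
    obtain ⟨x, hx, e⟩ := hφ.attained
    have := hsub hx
    rw [mem_ofPred_eq, e] at this
    exact le_of_mul_le_mul_right this (den_pos hy hp hn hx)

end IsMinLevel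
end MinLevel

/-! ### The two candidate placements -/

/-- The locations of the masses that enter `S₁`. -/
def placement₁ (y : ℕ → ℝ) (ys : ℝ) (j₁ j₂ i : ℕ) : ℝ :=
  if i ≤ j₁ ∨ j₂ < i then y (i - 1) else if i < j₂ then y i else ys

/-- The locations of the masses that enter `S₂`. -/
def placement₂ (y : ℕ → ℝ) (ys : ℝ) (j₁ j₂ i : ℕ) : ℝ :=
  if i < j₁ ∨ j₂ < i then y (i - 1) else if i < j₂ then y i else ys

section Placement

variable {u : ℝ → ℝ} {n : ℕ} {y p : ℕ → ℝ} {ys : ℝ} {j₁ j₂ : ℕ}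

lemma placement_eq {i : ℕ} (hi : i ≠ j₁) :
    placement₂ y ys j₁ j₂ i = placement₁ y ys j₁ j₂ i := by
  have : i < j₁ ↔ i ≤ j₁ := ⟨le_of_lt, fun h => lt_of_le_of_ne h hi⟩
  simp only [placement₁, placement₂, this]

lemma sum_Icc_succ_add {a b c : ℕ} (hab : a ≤ b + 1) (hbc : b ≤ c) (v : ℕ → ℝ) :
    ∑ i ∈ Finset.Icc a c, v i = ∑ i ∈ Finset.Icc a b, v i + ∑ i ∈ Finset.Icc (b + 1) c, v i := by
  rw [← Finset.sum_union (Finset.disjoint_left.2 fun i hi hi' => by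
    rw [Finset.mem_Icc] at hi hi'; omega)]
  refine Finset.sum_congr (Finset.ext fun i => ?_) fun _ _ => rfl
  simp only [Finset.mem_union, Finset.mem_Icc]
  omega

/-- A mass at `y 0 = 0` contributes nothing to `f` or `g`, so sums starting at `2` can be read as
sums over all cells. -/
lemma sum_eq_of_zero_first (hu : u (y 0) = 0) (hn : 1 ≤ n) :
    ∑ i ∈ Finset.Icc 1 n, u (y (i - 1)) * p i = ∑ i ∈ Finset.Icc 2 n, u (y (i - 1)) * p i := by
  rw [sum_Icc_succ_add (b := 1) (by omega) hn]
  simp [hu]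

lemma S₁_eq (hu : u (y 0) = 0) (h1 : 1 ≤ j₁) (h12 : j₁ ≤ j₂) (h2 : j₂ ≤ n) :
    S₁ u n y p ys j₁ j₂ = ∑ i ∈ Finset.Icc 1 n, u (placement₁ y ys j₁ j₂ i) * p i := by
  unfold S₁
  split_ifs with hlt
  · rw [sum_Icc_succ_add (a := 1) (b := j₁) (c := n) (by omega) (by omega),
      sum_Icc_succ_add (a := j₁ + 1) (b := j₂ - 1) (c := n) (by omega) (by omega),
      sum_Icc_succ_add (a := j₂ - 1 + 1) (b := j₂) (c := n) (by omega) (by omega),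
      ← sum_eq_of_zero_first hu h1, ← add_assoc, ← add_assoc]
    congr 1
    · congr 1
      · congr 1
        · refine Finset.sum_congr rfl fun i hi => ?_
          rw [Finset.mem_Icc] at hi
          rw [placement₁, if_pos (by omega)]
        · refine Finset.sum_congr rfl fun i hi => ?_
          rw [Finset.mem_Icc] at hi
          rw [placement₁, if_neg (by omega), if_pos (by omega)]
      · rw [show j₂ - 1 + 1 = j₂ by omega, Finset.Icc_self, Finset.sum_singleton,
          placement₁, if_neg (by omega), if_neg (by omega)]
    · refine Finset.sum_congr rfl fun i hi => ?_
      rw [Finset.mem_Icc] at hi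
      rw [placement₁, if_pos (by omega)]
  · rw [← sum_eq_of_zero_first hu (by omega)]
    refine Finset.sum_congr rfl fun i hi => ?_
    rw [placement₁, if_pos (by omega)]

lemma S₂_eq (hu : u (y 0) = 0) (h1 : 1 ≤ j₁) (h12 : j₁ ≤ j₂) (h2 : j₂ ≤ n) :
    S₂ u n y p ys j₁ j₂ = ∑ i ∈ Finset.Icc 1 n, u (placement₂ y ys j₁ j₂ i) * p i := by
  have hS : S₂ u n y p ys j₁ j₂ = ∑ i ∈ Finset.Icc 2 (j₁ - 1), u (y (i - 1)) * p i
      + ∑ i ∈ Finset.Icc j₁ (j₂ - 1), u (y i) * p i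
      + u ys * p j₂
      + ∑ i ∈ Finset.Icc (j₂ + 1) n, u (y (i - 1)) * p i := by
    -- When `j₁ = j₂` the middle sum is empty, so one formula covers both branches.
    unfold S₂
    split_ifs with hlt
    · rfl
    · obtain rfl : j₁ = j₂ := by omega
      rw [Finset.Icc_eq_empty (a := j₁) (b := j₁ - 1) (by omega), Finset.sum_empty, add_zero]
  have hfirst : ∑ i ∈ Finset.Icc 2 (j₁ - 1), u (y (i - 1)) * p i
      = ∑ i ∈ Finset.Icc 1 (j₁ - 1), u (y (i - 1)) * p i := by
    rcases Nat.eq_or_lt_of_le h1 with he | hlt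
    · simp [← he]
    · exact (sum_eq_of_zero_first hu (by omega)).symm
  rw [hS, hfirst, sum_Icc_succ_add (a := 1) (b := j₁ - 1) (c := n) (by omega) (by omega),
    sum_Icc_succ_add (a := j₁ - 1 + 1) (b := j₂ - 1) (c := n) (by omega) (by omega),
    sum_Icc_succ_add (a := j₂ - 1 + 1) (b := j₂) (c := n) (by omega) (by omega),
    ← add_assoc, ← add_assoc]
  rw [show j₁ - 1 + 1 = j₁ by omega, show j₂ - 1 + 1 = j₂ by omega]
  congr 1
  · congr 1
    · congr 1
      · refine Finset.sum_congr rfl fun i hi => ?_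
        rw [Finset.mem_Icc] at hi
        rw [placement₂, if_pos (by omega)]
      · refine Finset.sum_congr rfl fun i hi => ?_
        rw [Finset.mem_Icc] at hi
        rw [placement₂, if_neg (by omega), if_pos (by omega)]
    · rw [Finset.Icc_self, Finset.sum_singleton, placement₂, if_neg (by omega),
        if_neg (by omega)]
  · refine Finset.sum_congr rfl fun i hi => ?_
    rw [Finset.mem_Icc] at hi
    rw [placement₂, if_pos (by omega)]

/-- The critical points `yss` and `ys` lie in the closed cells `j₁ ≤ j₂`. -/
structure InCells (n : ℕ) (y : ℕ → ℝ) (ys yss : ℝ) (j₁ j₂ : ℕ) : Prop where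
  one_le : 1 ≤ j₁
  le : j₁ ≤ j₂
  le_n : j₂ ≤ n
  yss_mem : yss ∈ Icc (y (j₁ - 1)) (y j₁)
  ys_mem : ys ∈ Icc (y (j₂ - 1)) (y j₂)

variable {yss : ℝ}

lemma placement₁_mem_box (hy : IsPartition n y) (hc : InCells n y ys yss j₁ j₂) :
    placement₁ y ys j₁ j₂ ∈ box n y := by
  refine mem_box.2 fun i hi => ?_
  have hi' := Finset.mem_Icc.1 hi
  have hle := hy.mono (Nat.sub_le i 1) hi'.2
  unfold placement₁
  split_ifs with h1 h2
  · exact ⟨le_rfl, hle⟩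
  · exact ⟨hle, le_rfl⟩
  · obtain rfl : i = j₂ := by omega
    exact hc.ys_mem

lemma placement₂_mem_box (hy : IsPartition n y) (hc : InCells n y ys yss j₁ j₂) :
    placement₂ y ys j₁ j₂ ∈ box n y := by
  refine mem_box.2 fun i hi => ?_
  have hi' := Finset.mem_Icc.1 hi
  have hle := hy.mono (Nat.sub_le i 1) hi'.2
  unfold placement₂
  split_ifs with h1 h2
  · exact ⟨le_rfl, hle⟩
  · exact ⟨hle, le_rfl⟩
  · have := hc.le
    obtain rfl : i = j₂ := by omega
    exact hc.ys_mem

variable {m k r φ : ℝ}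

/-- Away from cell `j₁`, each cell lies in one monotone piece of `gain` or contains its local
minimum `ys`, so the minimiser does not depend on `x`. -/
lemma gain_placement₁_le (hm : 0 < m) (hk : 0 < k) (hr : 0 < r) (hy : IsPartition n y)
    (hc : InCells n y ys yss j₁ j₂) (c : IsCriticalPair m k r φ ys yss) {x : ℕ → ℝ}
    (hx : x ∈ box n y) {i : ℕ} (hi : i ∈ Finset.Icc 1 n) (hij : i ≠ j₁) :
    gain m k r φ (placement₁ y ys j₁ j₂ i) ≤ gain m k r φ (x i) := by
  have hi' := Finset.mem_Icc.1 hi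
  obtain ⟨hxl, hxr⟩ := mem_box.1 hx i hi
  have hxu := mem_unit_of_mem_box hy hx hi
  have hle := c.le_one
  have hnn := c.nonneg
  have := hc.le
  have := hc.le_n
  unfold placement₁
  split_ifs with h1 h2
  · rcases h1 with h1 | h1
    · have e := hy.mono (show i ≤ j₁ - 1 by omega) (by omega)
      have := hc.yss_mem.1
      have := (hy.mem_unit (show i - 1 ≤ n by omega)).1
      exact c.monotoneOn_left hm hk hr ⟨by linarith, by linarith⟩ ⟨by linarith, by linarith⟩ hxl
    · have e := hy.mono (show j₂ ≤ i - 1 by omega) (by omega)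
      have := hc.ys_mem.2
      exact c.monotoneOn_right hm hk hr ⟨by linarith, by linarith [hxu.2]⟩
        ⟨by linarith, hxu.2⟩ hxl
  · have e := hy.mono (show j₁ ≤ i - 1 by omega) (by omega)
    have e' := hy.mono (show i ≤ j₂ - 1 by omega) (by omega)
    have := hc.yss_mem.2
    have := hc.ys_mem.1
    exact c.antitoneOn_mid hm hk hr ⟨by linarith, by linarith⟩ ⟨by linarith, by linarith⟩ hxr
  · have e := hy.mono (show j₁ ≤ i - 1 by omega) (by omega)
    have := hc.yss_mem.2
    have hlt := c.lt hm hk hr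
    rcases le_total (x i) ys with hxy | hxy
    · exact c.antitoneOn_mid hm hk hr ⟨by linarith, hxy⟩ ⟨hlt.le, le_rfl⟩ hxy
    · exact c.monotoneOn_right hm hk hr ⟨le_rfl, hle⟩ ⟨hxy, hxu.2⟩ hxy

/-- In the cell of the local maximum `yss`, moving away from `yss` lowers `gain`: to the left
endpoint if `x j₁ ≤ yss`, otherwise to the right endpoint, or to `ys` if that lies in the same cell.
-/
lemma gain_placement_le_or (hm : 0 < m) (hk : 0 < k) (hr : 0 < r) (hy : IsPartition n y)
    (hc : InCells n y ys yss j₁ j₂) (c : IsCriticalPair m k r φ ys yss) {x : ℕ → ℝ}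
    (hx : x ∈ box n y) :
    gain m k r φ (placement₁ y ys j₁ j₂ j₁) ≤ gain m k r φ (x j₁) ∨
      gain m k r φ (placement₂ y ys j₁ j₂ j₁) ≤ gain m k r φ (x j₁) := by
  have h12 := hc.le
  have h2n := hc.le_n
  have hi : j₁ ∈ Finset.Icc 1 n := Finset.mem_Icc.2 ⟨hc.one_le, by omega⟩
  obtain ⟨hxl, hxr⟩ := mem_box.1 hx j₁ hi
  have hxu := mem_unit_of_mem_box hy hx hi
  have hlt := c.lt hm hk hr
  rcases le_total (x j₁) yss with hxy | hxy
  · left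
    rw [placement₁, if_pos (by omega)]
    have := (hy.mem_unit (show j₁ - 1 ≤ n by omega)).1
    exact c.monotoneOn_left hm hk hr ⟨by linarith, by linarith⟩ ⟨by linarith, by linarith⟩ hxl
  · right
    rw [placement₂, if_neg (by omega)]
    split_ifs with hlt'
    · have := hy.mono (show j₁ ≤ j₂ - 1 by omega) (by omega)
      have := hc.ys_mem.1
      exact c.antitoneOn_mid hm hk hr ⟨by linarith, by linarith⟩ ⟨by linarith, by linarith⟩ hxr
    · rcases le_total (x j₁) ys with hxs | hxs
      · exact c.antitoneOn_mid hm hk hr ⟨hxy, hxs⟩ ⟨hlt.le, le_rfl⟩ hxs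
      · exact c.monotoneOn_right hm hk hr ⟨le_rfl, c.le_one⟩ ⟨hxs, hxu.2⟩ hxs

/-- Which alternative holds may depend on `x`; this is harmless, since both placement sums get
compared with the same bound `0`. -/
lemma sum_gain_placement_le_or (hm : 0 < m) (hk : 0 < k) (hr : 0 < r) (hy : IsPartition n y)
    (hp : ∀ i ∈ Finset.Icc 1 n, 0 < p i)
    (hc : InCells n y ys yss j₁ j₂) (c : IsCriticalPair m k r φ ys yss) {x : ℕ → ℝ}
    (hx : x ∈ box n y) :
    ∑ i ∈ Finset.Icc 1 n, gain m k r φ (placement₁ y ys j₁ j₂ i) * p i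
        ≤ ∑ i ∈ Finset.Icc 1 n, gain m k r φ (x i) * p i ∨
      ∑ i ∈ Finset.Icc 1 n, gain m k r φ (placement₂ y ys j₁ j₂ i) * p i
        ≤ ∑ i ∈ Finset.Icc 1 n, gain m k r φ (x i) * p i := by
  refine (gain_placement_le_or hm hk hr hy hc c hx).imp (fun hj => ?_) fun hj => ?_
  · refine Finset.sum_le_sum fun i hi => mul_le_mul_of_nonneg_right ?_ (hp i hi).le
    rcases eq_or_ne i j₁ with rfl | hij
    · exact hj
    · exact gain_placement₁_le hm hk hr hy hc c hx hi hij
  · refine Finset.sum_le_sum fun i hi => mul_le_mul_of_nonneg_right ?_ (hp i hi).le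
    rcases eq_or_ne i j₁ with rfl | hij
    · exact hj
    · rw [placement_eq hij]
      exact gain_placement₁_le hm hk hr hy hc c hx hi hij

end Placement

end CBI

/-! ### Fixed points are minimal levels, and conversely -/

namespace CBI

section FixedPoint

variable {m k r φ ys yss : ℝ} {n : ℕ} {y p : ℕ → ℝ} {j₁ j₂ : ℕ}

lemma φ₁_eq (hr : 0 < r) (hy : IsPartition n y) (hc : InCells n y ys yss j₁ j₂) :
    φ₁ m k r n y p ys j₁ j₂
      = num m k r n p (placement₁ y ys j₁ j₂) / den k r n p (placement₁ y ys j₁ j₂) := by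
  rw [φ₁, S₁_eq (by rw [hy.zero, f_zero hr]) hc.one_le hc.le hc.le_n,
    S₁_eq (by rw [hy.zero, g_zero hr]) hc.one_le hc.le hc.le_n, num, den]

lemma φ₂_eq (hr : 0 < r) (hy : IsPartition n y) (hc : InCells n y ys yss j₁ j₂) :
    φ₂ m k r n y p ys j₁ j₂
      = num m k r n p (placement₂ y ys j₁ j₂) / den k r n p (placement₂ y ys j₁ j₂) := by
  rw [φ₂, S₂_eq (by rw [hy.zero, f_zero hr]) hc.one_le hc.le hc.le_n,
    S₂_eq (by rw [hy.zero, g_zero hr]) hc.one_le hc.le hc.le_n, num, den]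

namespace IsFixedPoint

lemma inCells (hf : IsFixedPoint m k r n y p φ ys yss j₁ j₂) (hy : IsPartition n y) :
    InCells n y ys yss j₁ j₂ := by
  have h1 := hf.one_le
  have h2 := hf.le
  have h3 := hf.le_n
  refine ⟨h1, h2, h3, ?_, ?_⟩
  · rw [← hy.closure_I (Finset.mem_Icc.2 ⟨by omega, by omega⟩)]
    exact hf.yss_mem
  · rw [← hy.closure_I (Finset.mem_Icc.2 ⟨by omega, by omega⟩)]
    exact hf.ys_mem

lemma isCriticalPair (hf : IsFixedPoint m k r n y p φ ys yss j₁ j₂) (hy : IsPartition n y) :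
    IsCriticalPair m k r φ ys yss := by
  have hc := hf.inCells hy
  have := hc.le
  have := hc.le_n
  exact ⟨(hy.mem_unit (by omega)).1.trans hc.yss_mem.1,
    hc.ys_mem.2.trans (hy.mem_unit (by omega)).2, hf.h_yss, hf.h_ys, hf.yss_lt, hf.lt_ys⟩

lemma isMinLevel (hf : IsFixedPoint m k r n y p φ ys yss j₁ j₂) (hm : 0 < m) (hk : 0 < k)
    (hr : 0 < r) (hy : IsPartition n y) (hp : ∀ i ∈ Finset.Icc 1 n, 0 < p i) (hn : 3 ≤ n) :
    IsMinLevel m k r n y p φ := by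
  have hc := hf.inCells hy
  have hx₁ := placement₁_mem_box hy hc
  have hx₂ := placement₂_mem_box hy hc
  have d₁ := den_pos (k := k) (r := r) hy hp hn hx₁
  have d₂ := den_pos (k := k) (r := r) hy hp hn hx₂
  have hmin := hf.eq_min
  rw [φ₁_eq hr hy hc, φ₂_eq hr hy hc] at hmin
  have l₁ := (le_div_iff₀ d₁).1 (hmin.le.trans (min_le_left _ _))
  have l₂ := (le_div_iff₀ d₂).1 (hmin.le.trans (min_le_right _ _))
  refine ⟨fun x hx => ?_, ?_⟩
  -- By `l₁` and `l₂` both placements have nonnegative total gain, hence so has `x`.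
  · have := sum_gain_placement_le_or hm hk hr hy hp hc (hf.isCriticalPair hy) hx
    simp only [sum_gain] at this
    rcases this with h | h <;> linarith
  · rcases min_choice (num m k r n p (placement₁ y ys j₁ j₂) / den k r n p (placement₁ y ys j₁ j₂))
      (num m k r n p (placement₂ y ys j₁ j₂) / den k r n p (placement₂ y ys j₁ j₂)) with e | e
    · exact ⟨_, hx₁, ((eq_div_iff d₁.ne').1 (hmin.trans e)).symm⟩
    · exact ⟨_, hx₂, ((eq_div_iff d₂.ne').1 (hmin.trans e)).symm⟩

end IsFixedPoint

lemma IsMinLevel.isFixedPoint (hφ : IsMinLevel m k r n y p φ)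
    (c : IsCriticalPair m k r φ ys yss) (hc : InCells n y ys yss j₁ j₂) (hm : 0 < m) (hk : 0 < k)
    (hr : 0 < r) (hy : IsPartition n y) (hp : ∀ i ∈ Finset.Icc 1 n, 0 < p i) (hn : 3 ≤ n) :
    IsFixedPoint m k r n y p φ ys yss j₁ j₂ := by
  have h1 := hc.one_le
  have h2 := hc.le
  have h3 := hc.le_n
  have hx₁ := placement₁_mem_box hy hc
  have hx₂ := placement₂_mem_box hy hc
  have d₁ := den_pos (k := k) (r := r) hy hp hn hx₁
  have d₂ := den_pos (k := k) (r := r) hy hp hn hx₂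
  refine ⟨h1, h2, h3, c.h_yss, c.h_ys, ?_, c.yss_lt, div_lt_div_mid hm hk hr, c.lt_ys, ?_, ?_⟩
  · rw [φ₁_eq hr hy hc, φ₂_eq hr hy hc]
    refine le_antisymm (le_min ((le_div_iff₀ d₁).2 (hφ.le _ hx₁))
      ((le_div_iff₀ d₂).2 (hφ.le _ hx₂))) ?_
    obtain ⟨x, hx, e⟩ := hφ.attained
    have := sum_gain_placement_le_or hm hk hr hy hp hc c hx
    simp only [sum_gain] at this
    rcases this with h | h
    · exact (min_le_left _ _).trans ((div_le_iff₀ d₁).2 (by linarith))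
    · exact (min_le_right _ _).trans ((div_le_iff₀ d₂).2 (by linarith))
  · rw [hy.closure_I (Finset.mem_Icc.2 ⟨by omega, by omega⟩)]
    exact hc.yss_mem
  · rw [hy.closure_I (Finset.mem_Icc.2 ⟨by omega, by omega⟩)]
    exact hc.ys_mem

lemma IsCriticalPair.exists_inCells (c : IsCriticalPair m k r φ ys yss) (hm : 0 < m)
    (hk : 0 < k) (hr : 0 < r) (hy : IsPartition n y) : ∃ j₁ j₂, InCells n y ys yss j₁ j₂ := by
  have hlt := c.lt hm hk hr
  have h0 := c.nonneg
  have h1 := c.le_one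
  obtain ⟨j₁, a1, -, a3, a4⟩ := hy.exists_mem_cell h0 (by linarith)
  obtain ⟨j₂, b1, b2, b3, -⟩ := hy.exists_mem_cell (t := ys) (by linarith) h1
  exact ⟨j₁, j₂, a1, a4 j₂ b1 (hlt.le.trans b3.2), b2, a3, b3⟩

/-- If the second value is strictly smaller than the first, the first cell is not that of `yss`,
so the mass of the first cell sits at `0` in either placement. -/
lemma IsFixedPoint.one_lt (hf : IsFixedPoint m k r n y p φ ys yss j₁ j₂) (hm : 0 < m)
    (hk : 0 < k) (hr : 0 < r) (hy : IsPartition n y) (hp : ∀ i ∈ Finset.Icc 1 n, 0 < p i)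
    (hn : 3 ≤ n) (hne : φ ≠ φ₁ m k r n y p ys j₁ j₂) : 1 < j₁ := by
  have hc := hf.inCells hy
  have hx₁ := placement₁_mem_box hy hc
  have hx₂ := placement₂_mem_box hy hc
  have hφ := hf.isMinLevel hm hk hr hy hp hn
  have d₁ := den_pos (k := k) (r := r) hy hp hn hx₁
  have d₂ := den_pos (k := k) (r := r) hy hp hn hx₂
  have hmin := hf.eq_min
  have e₂ : φ = φ₂ m k r n y p ys j₁ j₂ := by
    rcases min_choice (φ₁ m k r n y p ys j₁ j₂) (φ₂ m k r n y p ys j₁ j₂) with e | e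
    · exact absurd (hmin.trans e) hne
    · exact hmin.trans e
  have lt₁ : φ < φ₁ m k r n y p ys j₁ j₂ :=
    lt_of_le_of_ne (hmin.le.trans (min_le_left _ _)) hne
  rw [φ₁_eq hr hy hc, lt_div_iff₀ d₁] at lt₁
  rw [φ₂_eq hr hy hc, eq_div_iff d₂.ne'] at e₂
  by_contra! hj
  obtain rfl : j₁ = 1 := le_antisymm hj hf.one_le
  have s₁ := sum_gain m k r φ n p (placement₁ y ys 1 j₂)
  have s₂ := sum_gain m k r φ n p (placement₂ y ys 1 j₂)
  rw [sum_Icc_succ_add (a := 1) (b := 1) (by omega) (by omega), Finset.Icc_self,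
    Finset.sum_singleton] at s₁ s₂
  have tail : ∑ i ∈ Finset.Icc (1 + 1) n, gain m k r φ (placement₂ y ys 1 j₂ i) * p i
      = ∑ i ∈ Finset.Icc (1 + 1) n, gain m k r φ (placement₁ y ys 1 j₂ i) * p i :=
    Finset.sum_congr rfl fun i hi => by
      rw [Finset.mem_Icc] at hi
      rw [placement_eq (by omega)]
  have first : placement₁ y ys 1 j₂ 1 = 0 := by
    rw [placement₁, if_pos (Or.inl le_rfl)]
    exact hy.zero
  rw [first, gain_zero hr, zero_mul, zero_add] at s₁
  rw [tail, s₁] at s₂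
  have m1 : (1 : ℕ) ∈ Finset.Icc 1 n := Finset.mem_Icc.2 ⟨le_rfl, by omega⟩
  -- The second placement has total gain zero and the first a positive one; they share their tail,
  -- so the first mass must contribute negatively.
  have hneg : gain m k r φ (placement₂ y ys 1 j₂ 1) < 0 := by
    by_contra! hcon
    have := mul_nonneg hcon (hp 1 m1).le
    linarith
  -- All later masses lie to the right of that point, where `gain` is nonpositive; this contradicts
  -- the positive total of the first placement.
  have hle : ∑ i ∈ Finset.Icc (1 + 1) n, gain m k r φ (placement₁ y ys 1 j₂ i) * p i ≤ 0 := by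
    refine Finset.sum_nonpos fun i hi => ?_
    rw [Finset.mem_Icc] at hi
    have mi : i ∈ Finset.Icc 1 n := Finset.mem_Icc.2 ⟨by omega, hi.2⟩
    refine mul_nonpos_of_nonpos_of_nonneg ?_ (hp i mi).le
    have b := mem_box.1 hx₂ 1 m1
    have b' := mem_box.1 hx₁ i mi
    have := hy.mono (show 1 ≤ i - 1 by omega) (by omega)
    exact gain_nonpos_of_neg hm hk (mem_unit_of_mem_box hy hx₂ m1).1
      (b.2.trans (this.trans b'.1)) (mem_unit_of_mem_box hy hx₁ mi).2 hneg
  rw [s₁] at hle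
  linarith

lemma loc_eq_placement₁ (hy : IsPartition n y) (hn : 3 ≤ n)
    (hc : InCells n y ys yss j₁ j₂) (he : φ = φ₁ m k r n y p ys j₁ j₂) {i : ℕ} (hi : 1 ≤ i) :
    loc m k r n y p φ ys j₁ j₂ i = placement₁ y ys j₁ j₂ i := by
  have h1 := hc.one_le
  have h2 := hc.le
  rcases Nat.eq_or_lt_of_le hi with rfl | hi
  · rw [loc, if_pos rfl, if_neg (by omega), placement₁, if_pos (by omega)]
    exact hy.zero.symm
  rw [loc, if_neg (by omega), if_pos he, placement₁]
  by_cases c1 : i < j₁ ∨ j₂ < i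
  · rw [if_pos c1, if_pos (by omega)]
  rw [if_neg c1]
  by_cases c2 : j₁ < i ∧ i < j₂
  · rw [if_pos c2, if_neg (by omega), if_pos c2.2]
  rw [if_neg c2]
  by_cases c3 : i = j₁
  · subst c3
    rw [if_pos rfl, if_pos (by omega)]
  · rw [if_neg c3, if_neg (by omega), if_neg (by omega)]

lemma loc_eq_placement₂ (hy : IsPartition n y) (hn : 3 ≤ n)
    (hc : InCells n y ys yss j₁ j₂) (he : φ ≠ φ₁ m k r n y p ys j₁ j₂) (hj : 1 < j₁) {i : ℕ}
    (hi : 1 ≤ i) : loc m k r n y p φ ys j₁ j₂ i = placement₂ y ys j₁ j₂ i := by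
  have h2 := hc.le
  have h3 := hc.le_n
  rcases Nat.eq_or_lt_of_le hi with rfl | hi
  · rw [loc, if_pos rfl, if_neg (by omega), placement₂, if_pos (by omega)]
    exact hy.zero.symm
  rw [loc, if_neg (by omega), if_neg he, placement₂]
  by_cases c1 : i < j₁ ∨ j₂ < i
  · rw [if_pos c1, if_pos c1]
  rw [if_neg c1, if_neg c1]
  by_cases c2 : j₁ < i ∧ i < j₂
  · rw [if_pos c2, if_pos c2.2]
  rw [if_neg c2]
  by_cases c3 : i = j₁
  · subst c3
    rw [if_pos rfl]
    -- The minimum with `ys` selects `y j₁` when `j₁ < j₂` and `ys` when the two cells coincide.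
    split_ifs with c4
    · exact min_eq_left ((hy.mono (by omega) (by omega)).trans hc.ys_mem.1)
    · obtain rfl : i = j₂ := by omega
      exact min_eq_right hc.ys_mem.2
  · rw [if_neg c3, if_neg (by omega)]

lemma IsFixedPoint.loc_spec (hf : IsFixedPoint m k r n y p φ ys yss j₁ j₂) (hm : 0 < m)
    (hk : 0 < k) (hr : 0 < r) (hy : IsPartition n y) (hp : ∀ i ∈ Finset.Icc 1 n, 0 < p i)
    (hn : 3 ≤ n) :
    loc m k r n y p φ ys j₁ j₂ ∈ box n y ∧
      objective m k r n p (loc m k r n y p φ ys j₁ j₂) = φ := by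
  have hc := hf.inCells hy
  have congr_of : ∀ z ∈ box n y, num m k r n p z / den k r n p z = φ →
      (∀ i, 1 ≤ i → loc m k r n y p φ ys j₁ j₂ i = z i) →
      loc m k r n y p φ ys j₁ j₂ ∈ box n y ∧
        objective m k r n p (loc m k r n y p φ ys j₁ j₂) = φ := by
    intro z hz hzφ hloc
    constructor
    · rw [mem_box] at hz ⊢
      intro i hi
      rw [hloc i (Finset.mem_Icc.1 hi).1]
      exact hz i hi
    · refine Eq.trans (congrArg₂ (· / ·) ?_ ?_) hzφ <;>
      exact Finset.sum_congr rfl fun i hi => by rw [hloc i (Finset.mem_Icc.1 hi).1]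
  by_cases he : φ = φ₁ m k r n y p ys j₁ j₂
  · exact congr_of _ (placement₁_mem_box hy hc) (by rw [← φ₁_eq hr hy hc, ← he])
      fun i hi => loc_eq_placement₁ hy hn hc he hi
  · have hj := hf.one_lt hm hk hr hy hp hn he
    refine congr_of _ (placement₂_mem_box hy hc) ?_
      fun i hi => loc_eq_placement₂ hy hn hc he hj hi
    rw [← φ₂_eq hr hy hc]
    rcases min_choice (φ₁ m k r n y p ys j₁ j₂) (φ₂ m k r n y p ys j₁ j₂) with e | e
    · exact absurd (hf.eq_min.trans e) he
    · exact (hf.eq_min.trans e).symm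

end FixedPoint

/-! ### The prior as a probability measure -/

section Prior

variable {m k r φ ys : ℝ} {n : ℕ} {y p : ℕ → ℝ} {j₁ j₂ : ℕ}

lemma isProbabilityMeasure_prior (hp : ∀ i ∈ Finset.Icc 1 n, 0 < p i)
    (hp1 : ∑ i ∈ Finset.Icc 1 n, p i = 1) :
    IsProbabilityMeasure (prior m k r n y p φ ys j₁ j₂) := by
  constructor
  rw [prior, Measure.finsetSum_apply]
  simp only [Measure.smul_apply, measure_univ, smul_eq_mul, mul_one]
  rw [← ENNReal.ofReal_sum_of_nonneg fun i hi => (hp i hi).le, hp1, ENNReal.ofReal_one]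

lemma integral_prior (hp : ∀ i ∈ Finset.Icc 1 n, 0 < p i) (u : ℝ → ℝ) :
    ∫ x, u x ∂(prior m k r n y p φ ys j₁ j₂)
      = ∑ i ∈ Finset.Icc 1 n, u (loc m k r n y p φ ys j₁ j₂ i) * p i := by
  rw [prior, integral_finsetSum_measure]
  · refine Finset.sum_congr rfl fun i hi => ?_
    rw [integral_smul_measure, integral_dirac, ENNReal.toReal_ofReal (hp i hi).le, smul_eq_mul,
      mul_comm]
  · intro i _
    exact (integrable_dirac (by simp)).smul_measure ENNReal.ofReal_ne_top

end Prior

/-! ### The degenerate cases -/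

section Degenerate

variable {m k r : ℝ} {n : ℕ} {y p : ℕ → ℝ}

lemma den_single (hr : 0 < r) (hn : 1 ≤ n) (t : ℝ) :
    den k r n p (fun i => if i = n then t else 0) = g k r t * p n := by
  rw [den, Finset.sum_eq_single_of_mem n (Finset.mem_Icc.2 ⟨hn, le_rfl⟩)]
  · simp
  · intro i _ hi
    simp [hi, g_zero hr]

lemma num_single (hr : 0 < r) (hn : 1 ≤ n) (t : ℝ) :
    num m k r n p (fun i => if i = n then t else 0) = f m k r t * p n := by
  rw [num, Finset.sum_eq_single_of_mem n (Finset.mem_Icc.2 ⟨hn, le_rfl⟩)]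
  · simp
  · intro i _ hi
    simp [hi, f_zero hr]

lemma objective_single (hm : 0 < m) (hk : 0 < k) (hr : 0 < r) (hn : 1 ≤ n) (hpn : 0 < p n)
    {t : ℝ} (ht : t ∈ Ioo (0 : ℝ) 1) :
    objective m k r n p (fun i => if i = n then t else 0) = (1 - t) ^ m := by
  rw [objective, num_single hr hn, den_single hr hn, f_eq hm hk ht.2.le, mul_assoc,
    mul_div_cancel_right₀ _ (mul_pos (g_pos ht) hpn).ne']

lemma tendsto_objective_single (hm : 0 < m) (hk : 0 < k) (hr : 0 < r) (hn : 1 ≤ n)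
    (hpn : 0 < p n) :
    Tendsto (fun t : ℝ => objective m k r n p (fun i => if i = n then t else 0))
      (𝓝[<] 1) (𝓝 0) := by
  have hlim : Tendsto (fun t : ℝ => (1 - t) ^ m) (𝓝[<] 1) (𝓝 0) := by
    have hcont : Continuous fun t : ℝ => (1 - t) ^ m :=
      (continuous_const.sub continuous_id).rpow_const fun _ => Or.inr hm.le
    have := (hcont.tendsto 1).mono_left (nhdsWithin_le_nhds (s := Iio (1 : ℝ)))
    simpa [Real.zero_rpow hm.ne'] using this
  refine hlim.congr' ?_
  filter_upwards [Ioo_mem_nhdsLT (zero_lt_one' ℝ)] with t ht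
  exact (objective_single hm hk hr hn hpn ht).symm

lemma isGLB_values_zero (hm : 0 < m) (hk : 0 < k) (hr : 0 < r) (hy : IsPartition n y)
    (hp : ∀ i ∈ Finset.Icc 1 n, 0 < p i) (hn1 : 1 ≤ n) (hn : n ≤ 2) :
    IsGLB (values m k r n y p) 0 := by
  have hnn : n ∈ Finset.Icc 1 n := Finset.mem_Icc.2 ⟨hn1, le_rfl⟩
  constructor
  · rintro v ⟨x, hx, -, rfl⟩
    have hxb : x ∈ box n y := mem_box.2 fun i hi => hy.closure_I hi ▸ subset_closure (hx i hi)
    exact div_nonneg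
      (Finset.sum_nonneg fun i hi =>
        mul_nonneg (f_nonneg (mem_unit_of_mem_box hy hxb hi)) (hp i hi).le)
      (Finset.sum_nonneg fun i hi =>
        mul_nonneg (g_nonneg (mem_unit_of_mem_box hy hxb hi)) (hp i hi).le)
  · intro b hb
    refine ge_of_tendsto (tendsto_objective_single hm hk hr hn1 (hp n hnn)) ?_
    have hlt : y (n - 1) < 1 := hy.last ▸ hy.strictMono (by omega) le_rfl
    -- For `t` in the interior of the last cell, the test point is feasible with nonzero
    -- denominator.
    filter_upwards [Ioo_mem_nhdsLT hlt] with t ht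
    have h0 := (hy.mem_unit (show n - 1 ≤ n by omega)).1
    have ht' : t ∈ Ioo (0 : ℝ) 1 := ⟨h0.trans_lt ht.1, ht.2⟩
    refine hb ⟨_, fun i hi => ?_, ?_, rfl⟩
    · rw [Finset.mem_Icc] at hi
      by_cases hin : i = n
      · subst hin
        have hmem : t ∈ Ioc (y (i - 1)) (y i) := ⟨ht.1, hy.last ▸ ht.2.le⟩
        simp only [if_true, I]
        split_ifs with h1
        · subst h1
          exact Ioc_subset_Icc_self hmem
        · exact hmem
      -- Since `n ≤ 2`, the only other cell is the first, which contains `0`.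
      · obtain rfl : i = 1 := by omega
        simp only [if_neg hin, I, if_true]
        exact ⟨hy.zero.le, (hy.mem_unit hi.2).1⟩
    · rw [den_single hr hn1]
      exact (mul_pos (g_pos ht') (hp n hnn)).ne'

end Degenerate

end CBI

theorem theorem1 (m k r : ℝ) (hm : 0 < m) (hk : 0 < k) (hr : 0 < r)
    (n : ℕ) (y p : ℕ → ℝ)
    (hy0 : y 0 = 0) (hyn : y n = 1) (hy : ∀ i < n, y i < y (i + 1))
    (hp : ∀ i ∈ Finset.Icc 1 n, 0 < p i) (hp1 : ∑ i ∈ Finset.Icc 1 n, p i = 1) :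
    (3 ≤ n →
      ∃ φ ys yss : ℝ,
        -- the triple solves the fixed-point system
        (∃ j₁ j₂ : ℕ, CBI.IsFixedPoint m k r n y p φ ys yss j₁ j₂) ∧
        -- it is the only triple that does
        (∀ (φ' ys' yss' : ℝ) (j₁ j₂ : ℕ), CBI.IsFixedPoint m k r n y p φ' ys' yss' j₁ j₂ →
          φ' = φ ∧ ys' = ys ∧ yss' = yss) ∧
        -- its first component is the infimum
        IsGLB (CBI.values m k r n y p) φ ∧
        -- the infimum is attained by the conservative prior, a limit of feasible ones
        (∀ j₁ j₂ : ℕ, CBI.IsFixedPoint m k r n y p φ ys yss j₁ j₂ →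
          (∀ i ∈ Finset.Icc 1 n, CBI.loc m k r n y p φ ys j₁ j₂ i ∈ closure (CBI.I y i)) ∧
          IsProbabilityMeasure (CBI.prior m k r n y p φ ys j₁ j₂) ∧
          0 < ∫ x, CBI.g k r x ∂(CBI.prior m k r n y p φ ys j₁ j₂) ∧
          (∫ x, CBI.f m k r x ∂(CBI.prior m k r n y p φ ys j₁ j₂)) /
            (∫ x, CBI.g k r x ∂(CBI.prior m k r n y p φ ys j₁ j₂)) = φ)) ∧
    -- the degenerate cases `n = 1, 2`: the infimum is `0`, approached as `x_n → 1`
    (n ≤ 2 →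
      IsGLB (CBI.values m k r n y p) 0 ∧
      CBI.h m k r (r / (r + m + k)) = 0 ∧ CBI.h m k r 1 = 0 ∧
      Tendsto (fun t : ℝ => CBI.objective m k r n p (fun i => if i = n then t else 0))
        (𝓝[<] 1) (𝓝 0)) := by
  have hP : CBI.IsPartition n y := ⟨hy0, hyn, hy⟩
  refine ⟨fun hn => ?_, fun hn => ?_⟩
  · obtain ⟨φ, hφ⟩ := CBI.exists_isMinLevel hm hk hr hP hp hn
    obtain ⟨ys, yss, c⟩ := CBI.exists_isCriticalPair hm hk hr (hφ.pos hP hp hn)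
      (hφ.lt_one hm hk hP hp hn)
    obtain ⟨j₁, j₂, hc⟩ := c.exists_inCells hm hk hr hP
    refine ⟨φ, ys, yss, ⟨j₁, j₂, hφ.isFixedPoint c hc hm hk hr hP hp hn⟩, ?_,
      hφ.isGLB hm hk hr hP hp hn, ?_⟩
    · intro φ' ys' yss' i₁ i₂ hf
      -- Any solution has the minimal level as its first component, whatever its indices; equal
      -- levels then force equal critical points.
      obtain rfl : φ' = φ := hφ.unique (hf.isMinLevel hm hk hr hP hp hn) hP hp hn
      exact ⟨rfl, c.unique (hf.isCriticalPair hP) hm hk hr⟩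
    · intro i₁ i₂ hf
      obtain ⟨hbox, hobj⟩ := hf.loc_spec hm hk hr hP hp hn
      refine ⟨fun i hi => ?_, CBI.isProbabilityMeasure_prior hp hp1, ?_, ?_⟩
      · rw [hP.closure_I hi]
        exact CBI.mem_box.1 hbox i hi
      · rw [CBI.integral_prior hp]
        exact CBI.den_pos hP hp hn hbox
      · rw [CBI.integral_prior hp, CBI.integral_prior hp]
        exact hobj
  · have hn1 : 1 ≤ n := by
      rcases Nat.eq_zero_or_pos n with rfl | hn1
      · rw [hy0] at hyn
        norm_num at hyn
      · exact hn1
    refine ⟨CBI.isGLB_values_zero hm hk hr hP hp hn1 hn, ?_, ?_,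
      CBI.tendsto_objective_single hm hk hr hn1 (hp n (Finset.mem_Icc.2 ⟨hn1, le_rfl⟩))⟩
    · have e : r - r / (r + m + k) * (m + k + r) = 0 := by
        field_simp
        ring
      rw [CBI.h, e, zero_div, mul_zero]
    · rw [CBI.h, sub_self, Real.zero_rpow hm.ne', zero_mul]
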